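/- Assume $\mathsf{MA(countable)}$: for every non-empty countable poset $P$ and every collection $\mathcal{D}$ of dense subsets of $P$ with $|\mathcal{D}|<\mathfrak{c}$ there is a filter on $P$ that meets every $D\in\mathcal{D}$. Let $X$ be a crowded Polish space, that is, a non-empty Polish space without isolated points. A relation on $X$ is a set $R\subseteq X^{n}$ for some $n=n_R$ with $1\leq n<\omega$, and it is called meager if it is a meager subset of $X^{n_R}$. Let $\mathcal{R}$ be a collection of meager relations on $X$ such that $|\mathcal{R}|<\mathfrak{c}$. Then there exists $F\subseteq X$ such that 1. $F$ is dense in $X$; 2. $F$ is completely Baire, that is, every closed subspace of the space $F$ is a Baire space; 3. $F$ is $\mathcal{R}$-free, that is, for every $R\in\mathcal{R}$ and every injective $x\colon n_R\to F$ we have $x\notin R$. -/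

import Mathlib

open Cardinal

/-- A subset `D` of a poset `P` is dense if every element of `P` has an element of `D`
below it. -/
def IsForcingDense {P : Type*} [PartialOrder P] (D : Set P) : Prop :=
  ∀ p : P, ∃ q ∈ D, q ≤ p

/-- Martin's Axiom for countable posets: for every non-empty countable poset `P` and every
collection of fewer than `𝔠` dense subsets of `P`, there is a filter on `P` (a non-empty,
downward directed, upward closed subset) that meets all of them. Every countable poset is
isomorphic to one in `Type`. -/
def MACountable : Prop :=
  ∀ (P : Type) [PartialOrder P] [Nonempty P] [Countable P] (𝒟 : Set (Set P)),
    #𝒟 < 𝔠 → (∀ D ∈ 𝒟, IsForcingDense D) →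
      ∃ G : Set P, Order.IsPFilter G ∧ ∀ D ∈ 𝒟, (G ∩ D).Nonempty

/-- A relation on `X`: a subset of `X ^ n` for some `n` with `1 ≤ n < ω`. -/
structure FinitaryRelation (X : Type*) where
  /-- The number of arguments of the relation. -/
  arity : ℕ
  one_le_arity : 1 ≤ arity
  /-- The set of tuples that are related. -/
  carrier : Set (Fin arity → X)

/-- A relation is meager if it is a meager subset of the power `X ^ n` (product topology). -/
def FinitaryRelation.IsMeager {X : Type*} [TopologicalSpace X] (R : FinitaryRelation X) : Prop :=
  IsMeagre R.carrier

/-- `F` is `R`-free if no injective tuple of elements of `F` belongs to `R`. -/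
def IsRelFree {X : Type*} (R : FinitaryRelation X) (F : Set X) : Prop :=
  ∀ x : Fin R.arity → X, (∀ i, x i ∈ F) → Function.Injective x → x ∉ R.carrier

/-- A space is completely Baire if every closed subspace of it is Baire. -/
def CompletelyBaire (Y : Type*) [TopologicalSpace Y] : Prop :=
  ∀ C : Set Y, IsClosed C → BaireSpace C

open Set Filter Topology TopologicalSpace

-- Forcing with countable posets

universe u

/-! Countably many closed nowhere dense relations cover each meager one, so it suffices to avoid
fewer than `𝔠` closed nowhere dense relations. A generic sequence has dense free range. Then list
all pairs of a countable set and a sequence of open sets in order type at most `𝔠`; each stage adds,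
if freeness permits, the set and a point of its closure lying in all the open sets. For crowded `Q ⊆
F` and open sets dense in `Q`, `MACountable.exists_isRelFree_insert` shows that freeness did permit
it. By `completelyBaire_of_forall_countable` such points make `F` completely Baire. -/

theorem MACountable.exists_directedOn (hMA : MACountable) {P : Type u} [PartialOrder P]
    [Nonempty P] [Countable P] {κ : Type u} (hκ : #κ < 𝔠) (D : κ → Set P)
    (hD : ∀ k, IsForcingDense (D k)) :
    ∃ G : Set P, G.Nonempty ∧ DirectedOn (· ≥ ·) G ∧ ∀ k, (G ∩ D k).Nonempty := by
  let e : P ≃o Shrink.{0} P := orderIsoShrink.{0} P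
  have : Nonempty (Shrink.{0} P) := e.symm.toEquiv.nonempty
  have : Countable (Shrink.{0} P) := e.symm.toEquiv.countable_iff.2 inferInstance
  obtain ⟨G, hG, hGD⟩ := hMA (Shrink.{0} P) (range fun k => e.symm ⁻¹' D k)
    (by
      have h := mk_range_le_lift (f := fun k => e.symm ⁻¹' D k)
      rw [← lift_lt_continuum.{0, u}]
      refine lt_of_le_of_lt h ?_
      rwa [lift_lt_continuum])
    (by
      rintro _ ⟨k, rfl⟩ p
      obtain ⟨q, hq, hqp⟩ := hD k (e.symm p)
      exact ⟨e q, by simpa using hq, e.le_symm_apply.1 hqp⟩)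
  refine ⟨e ⁻¹' G, ?_, ?_, fun k => ?_⟩
  · obtain ⟨p, hp⟩ := hG.Nonempty
    exact ⟨e.symm (OrderDual.ofDual p), by simpa using hp⟩
  · intro a ha b hb
    obtain ⟨c, hc, hac, hbc⟩ := hG.Directed _ ha _ hb
    exact ⟨e.symm (OrderDual.ofDual c), by simpa using hc, e.symm_apply_le.2 hac,
      e.symm_apply_le.2 hbc⟩
  · obtain ⟨p, hpG, hpD⟩ := hGD _ ⟨k, rfl⟩
    exact ⟨e.symm p, by simpa using hpG, hpD⟩

/-- Force with basic open sets meeting `Q`, ordered by inclusion. The traces on `Q` of the generic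
sets generate a Cauchy filter, whose limit is the point. -/
theorem MACountable.exists_mem_closure (hMA : MACountable) {X : Type u} [TopologicalSpace X]
    [PolishSpace X] {κ : Type u} (hκ : #κ < 𝔠) {Q : Set X} (hQ : Q.Nonempty) (O : κ → Set X)
    (hO : ∀ k, IsOpen (O k)) (hd : ∀ k, Q ⊆ closure (Q ∩ O k)) :
    ∃ x ∈ closure Q, ∀ k, x ∈ O k := by
  let _ := upgradeIsCompletelyMetrizable X
  let P : Type u := {B : Set X // B ∈ countableBasis X ∧ (B ∩ Q).Nonempty}
  have hb := isBasis_countableBasis X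
  have refine_basis : ∀ (B : P) (q : X) (W : Set X), q ∈ Q → q ∈ B.1 → IsOpen W → q ∈ W →
      ∃ B' : P, B' ≤ B ∧ closure B'.1 ⊆ W := by
    intro B q W hqQ hqB hW hqW
    obtain ⟨V, hV, hqV, hVW⟩ := hb.exists_closure_subset
      ((((hb.isOpen B.2.1).inter hW)).mem_nhds ⟨hqB, hqW⟩)
    exact ⟨⟨V, hV, q, hqV, hqQ⟩, fun x hx => (hVW (subset_closure hx)).1,
      fun x hx => (hVW hx).2⟩
  have : Countable P :=
    ((countable_countableBasis X).mono fun B (hB : B ∈ countableBasis X ∧ (B ∩ Q).Nonempty) =>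
      hB.1).to_subtype
  have : Nonempty P := by
    obtain ⟨q, hq⟩ := hQ
    obtain ⟨V, hV, hqV, -⟩ := hb.exists_subset_of_mem_open (mem_univ q) isOpen_univ
    exact ⟨⟨V, hV, q, hqV, hq⟩⟩
  let D : κ ⊕ ULift.{u} ℕ → Set P := Sum.elim (fun k => {B | closure B.1 ⊆ O k})
    -- These extra dense sets make the filter Cauchy.
    (fun n => {B | ∃ c, closure B.1 ⊆ Metric.ball c (1 / ((n.down : ℝ) + 1))})
  have hDdense : ∀ k, IsForcingDense (D k) := by
    rintro (k | n) B
    · obtain ⟨q, hqB, hqQ⟩ := B.2.2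
      obtain ⟨q', hq'B, hq'Q, hq'O⟩ := mem_closure_iff.1 (hd k hqQ) _ (hb.isOpen B.2.1) hqB
      obtain ⟨B', hB', h⟩ := refine_basis B q' (O k) hq'Q hq'B (hO k) hq'O
      exact ⟨B', h, hB'⟩
    · obtain ⟨q, hqB, hqQ⟩ := B.2.2
      obtain ⟨B', hB', h⟩ := refine_basis B q (Metric.ball q (1 / ((n.down : ℝ) + 1))) hqQ hqB
        Metric.isOpen_ball (Metric.mem_ball_self (by positivity))
      exact ⟨B', ⟨q, h⟩, hB'⟩
  obtain ⟨G, hGne, hGdir, hGD⟩ := hMA.exists_directedOn (κ := κ ⊕ ULift.{u} ℕ)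
    (by
      simp only [mk_sum, lift_id, mk_uLift, mk_nat, lift_aleph0]
      exact add_lt_of_lt aleph0_le_continuum hκ aleph0_lt_continuum) D hDdense
  have : Nonempty G := hGne.to_subtype
  let f : Filter X := ⨅ B : G, 𝓟 (B.1.1 ∩ Q)
  have hfmem : ∀ B ∈ G, B.1 ∩ Q ∈ f := fun B hB =>
    mem_iInf_of_mem (⟨B, hB⟩ : G) (mem_principal_self _)
  have : f.NeBot := by
    refine iInf_neBot_of_directed' (fun A B => ?_) (fun B => ?_)
    · obtain ⟨C, hC, hAC, hBC⟩ := hGdir A.1 A.2 B.1 B.2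
      exact ⟨⟨C, hC⟩, principal_mono.2 (inter_subset_inter_left _ hAC),
        principal_mono.2 (inter_subset_inter_left _ hBC)⟩
    · exact principal_neBot_iff.2 B.1.2.2
  have hcauchy : Cauchy f := by
    refine Metric.cauchy_iff.2 ⟨inferInstance, fun ε hε => ?_⟩
    obtain ⟨n, hn⟩ := exists_nat_one_div_lt (half_pos hε)
    obtain ⟨B, hBG, c, hBc⟩ := hGD (Sum.inr ⟨n⟩)
    refine ⟨_, hfmem B hBG, fun x hx y hy => ?_⟩
    have h1 := Metric.mem_ball.1 (hBc (subset_closure hx.1))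
    have h2 := Metric.mem_ball.1 (hBc (subset_closure hy.1))
    have h3 := dist_triangle_right x y c
    simp only at h1 h2
    linarith
  obtain ⟨x, hx⟩ := CompleteSpace.complete hcauchy
  have hcl : ∀ B ∈ G, x ∈ closure (B.1 ∩ Q) := fun B hB =>
    mem_closure_iff_clusterPt.2 ((ClusterPt.of_le_nhds hx).mono (le_principal_iff.2 (hfmem B hB)))
  obtain ⟨B₀, hB₀⟩ := hGne
  refine ⟨x, closure_mono inter_subset_right (hcl B₀ hB₀), fun k => ?_⟩
  obtain ⟨B, hBG, hBO⟩ := hGD (Sum.inl k)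
  exact hBO (closure_mono inter_subset_left (hcl B hBG))

/-! ### Generic sequences and one-point extensions -/

theorem closure_diff_finite_of_preperfect {X : Type*} [TopologicalSpace X] [T1Space X]
    {Q S : Set X} (hQ : Preperfect Q) (hS : S.Finite) : Q ⊆ closure (Q \ S) := by
  intro q hq
  refine mem_closure_iff.2 fun U hU hqU => ?_
  obtain ⟨x, hx, hxS⟩ := ((hQ.open_inter hU) q ⟨hqU, hq⟩ |> Set.Infinite.of_accPt).exists_notMem_finite hS
  exact ⟨x, hx.1, hx.2, hxS⟩

/-- Fewer than continuum many tuples of elements of a set of size less than the continuum. -/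
theorem mk_sigma_tuples_lt_continuum {ι A : Type u} (hι : #ι < 𝔠) (hA : #A < 𝔠) (n : ι → ℕ) :
    #(Σ i, Fin (n i) × (Fin (n i) → A)) < 𝔠 := by
  set μ : Cardinal.{u} := max ℵ₀ (max #ι #A) with hμ
  have hμc : μ < 𝔠 := max_lt aleph0_lt_continuum (max_lt hι hA)
  have h0 : ℵ₀ ≤ μ := le_max_left _ _
  refine lt_of_le_of_lt ?_ hμc
  rw [mk_sigma]
  calc sum (fun i => #(Fin (n i) × (Fin (n i) → A))) ≤ sum (fun _ : ι => μ) := by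
        refine sum_le_sum _ _ fun i => ?_
        rw [mk_prod, mk_arrow]
        simp only [mk_fin, lift_natCast, lift_uzero]
        refine (mul_le_mul' ((natCast_lt_aleph0).le.trans h0) ?_).trans (mul_eq_self h0).le
        have hAμ : #A ≤ μ := (le_max_right _ _).trans (le_max_right _ _)
        refine (power_le_power_right hAμ).trans ?_
        rw [power_natCast]
        exact power_nat_le h0
    _ = #ι * μ := by simp
    _ ≤ μ * μ := mul_le_mul' ((le_max_left _ _).trans (le_max_right _ _)) le_rfl
    _ = μ := mul_eq_self h0

/-- The sequence is a generic point of the Polish space `ℕ → X`; each requirement is open dense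
there. -/
theorem MACountable.exists_denseRange_isRelFree (hMA : MACountable) {X : Type u}
    [TopologicalSpace X] [PolishSpace X] [Nonempty X] {ι : Type u} (hι : #ι < 𝔠)
    (N : ι → FinitaryRelation X) (hclosed : ∀ i, IsClosed (N i).carrier)
    (hnd : ∀ i, IsNowhereDense (N i).carrier) :
    ∃ x : ℕ → X, DenseRange x ∧ ∀ i, IsRelFree (N i) (range x) := by
  let κ : Type u := (Σ i, Fin (N i).arity × (Fin (N i).arity → ULift.{u} ℕ)) ⊕ countableBasis X
  let O : κ → Set (ℕ → X) := Sum.elim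
    (fun p => {x | Function.Injective p.2.2 → (fun k => x (p.2.2 k).down) ∉ (N p.1).carrier})
    (fun B => {x | ∃ m, x m ∈ B.1})
  have hκ : #κ < 𝔠 := by
    have h1 := mk_sigma_tuples_lt_continuum (A := ULift.{u} ℕ) hι
      (by simpa using aleph0_lt_continuum) (fun i => (N i).arity)
    have h2 : #(countableBasis X) < 𝔠 :=
      ((countable_countableBasis X).le_aleph0).trans_lt aleph0_lt_continuum
    simp only [κ, mk_sum, lift_id]
    exact add_lt_of_lt aleph0_le_continuum h1 h2
  have hO : ∀ k, IsOpen (O k) := by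
    rintro (⟨i, j, σ⟩ | B)
    · by_cases hσ : Function.Injective σ
      · have : O (Sum.inl ⟨i, j, σ⟩) =
            (fun x : ℕ → X => fun k => x (σ k).down) ⁻¹' (N i).carrierᶜ := by
          ext x; simp [O, hσ]
        rw [this]
        exact (hclosed i).isOpen_compl.preimage (by fun_prop)
      · have : O (Sum.inl ⟨i, j, σ⟩) = Set.univ := by
          ext x; simp [O, hσ]
        rw [this]; exact isOpen_univ
    · have : O (Sum.inr B) = ⋃ m, (fun x : ℕ → X => x m) ⁻¹' B.1 := by
        ext x; simp [O]
      rw [this]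
      exact isOpen_iUnion fun m =>
        ((isBasis_countableBasis X).isOpen B.2).preimage (continuous_apply m)
  have hdense : ∀ k, Dense (O k) := by
    rintro (⟨i, j, σ⟩ | B) z
    · by_cases hσ : Function.Injective σ
      · refine mem_closure_iff.2 fun W hW hzW => ?_
        let τ : Fin (N i).arity → ℕ := fun k => (σ k).down
        have hτ : Function.Injective τ := fun a b h => hσ (ULift.down_injective h)
        -- Varying only the coordinates in the range of `τ` puts a copy of the finite power through
        -- `z`, where nowhere density applies.
        let φ : (Fin (N i).arity → X) → ℕ → X := fun w => Function.extend τ w z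
        have hφ : Continuous φ := by
          refine continuous_pi fun m => ?_
          by_cases hm : ∃ k, τ k = m
          · obtain ⟨k, rfl⟩ := hm
            simpa only [φ, hτ.extend_apply] using continuous_apply k
          · simpa only [φ, Function.extend_apply' _ _ _ hm] using continuous_const
        have hφz : φ (fun k => z (τ k)) = z := by
          funext m
          by_cases hm : ∃ k, τ k = m
          · obtain ⟨k, rfl⟩ := hm
            simp only [φ, hτ.extend_apply]
          · simp only [φ, Function.extend_apply' _ _ _ hm]
        have hd : Dense (N i).carrierᶜ := by
          rw [← interior_eq_empty_iff_dense_compl, ← (hclosed i).closure_eq]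
          exact hnd i
        obtain ⟨w, hwW, hwN⟩ := hd.inter_open_nonempty (φ ⁻¹' W) (hW.preimage hφ)
          ⟨fun k => z (τ k), by simpa [hφz] using hzW⟩
        refine ⟨φ w, hwW, fun _ => ?_⟩
        have : (fun k => φ w (σ k).down) = w := by
          funext k
          exact hτ.extend_apply w z k
        simpa only [this, mem_compl_iff] using hwN
      · exact subset_closure fun h => absurd h hσ
    · obtain ⟨b, hb⟩ := nonempty_of_mem_countableBasis B.2
      have ht : Tendsto (fun m => Function.update z m b) atTop (𝓝 z) := by
        refine tendsto_pi_nhds.2 fun k => tendsto_const_nhds.congr' ?_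
        filter_upwards [eventually_gt_atTop k] with m hm
        rw [Function.update_of_ne hm.ne]
      exact mem_closure_of_tendsto ht (Eventually.of_forall fun m => ⟨m, by simpa using hb⟩)
  obtain ⟨x, -, hx⟩ := hMA.exists_mem_closure hκ (univ_nonempty (α := ℕ → X)) O hO
    (fun k => by simp [(hdense k).closure_eq])
  refine ⟨x, ?_, fun i t ht hinj htN => ?_⟩
  · refine (isBasis_countableBasis X).dense_iff.2 fun B hB _ => ?_
    obtain ⟨m, hm⟩ := hx (Sum.inr ⟨B, hB⟩)
    exact ⟨x m, hm, m, rfl⟩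
  · choose σ hσ using ht
    -- The index `0` is a filler; it only lets the cardinality bound be shared with the one-point
    -- extension.
    refine hx (Sum.inl ⟨i, ⟨0, (N i).one_le_arity⟩, fun k => ⟨σ k⟩⟩) (fun a b h => hinj ?_) ?_
    · rw [← hσ a, ← hσ b, ULift.up_injective h]
    · simpa only [hσ] using htN

/-- Fix all entries of a tuple but one. The admissible values of that entry form an open set, which
contains all of `Q` but finitely many points since `A ⊇ Q` is free; as `Q` is crowded, it is dense
in `Q`. -/
theorem MACountable.exists_isRelFree_insert (hMA : MACountable) {X : Type u}
    [TopologicalSpace X] [PolishSpace X] {ι : Type u} (hι : #ι < 𝔠)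
    (N : ι → FinitaryRelation X) (hclosed : ∀ i, IsClosed (N i).carrier) {A Q : Set X}
    (hA : #A < 𝔠) (hfree : ∀ i, IsRelFree (N i) A) (hQA : Q ⊆ A) (hQne : Q.Nonempty)
    (hQ : Preperfect Q) (O : ℕ → Set X) (hO : ∀ n, IsOpen (O n))
    (hd : ∀ n, Q ⊆ closure (Q ∩ O n)) :
    ∃ x ∈ closure Q, (∀ n, x ∈ O n) ∧ ∀ i, IsRelFree (N i) (insert x A) := by
  classical
  let κ : Type u := (Σ i, Fin (N i).arity × (Fin (N i).arity → A)) ⊕ ULift.{u} ℕ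
  let V : κ → Set X := Sum.elim
    (fun p => {x | InjOn p.2.2 {p.2.1}ᶜ →
      Function.update (fun k => (p.2.2 k : X)) p.2.1 x ∉ (N p.1).carrier})
    (fun n => O n.down)
  have hκ : #κ < 𝔠 := by
    have h1 := mk_sigma_tuples_lt_continuum hι hA (fun i => (N i).arity)
    simp only [κ, mk_sum, lift_id]
    exact add_lt_of_lt aleph0_le_continuum h1 (by simpa using aleph0_lt_continuum)
  have hV : ∀ k, IsOpen (V k) := by
    rintro (⟨i, j, y⟩ | n)
    · by_cases hy : InjOn y {j}ᶜ
      · have : V (Sum.inl ⟨i, j, y⟩) =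
            (fun x : X => Function.update (fun k => (y k : X)) j x) ⁻¹' (N i).carrierᶜ := by
          ext x; simp [V, hy]
        rw [this]
        exact (hclosed i).isOpen_compl.preimage (continuous_const.update j continuous_id)
      · have : V (Sum.inl ⟨i, j, y⟩) = Set.univ := by
          ext x; simp [V, hy]
        rw [this]; exact isOpen_univ
    · exact hO n.down
  have hVd : ∀ k, Q ⊆ closure (Q ∩ V k) := by
    rintro (⟨i, j, y⟩ | n)
    · refine (closure_diff_finite_of_preperfect hQ
        (finite_range fun k => (y k : X))).trans (closure_mono ?_)
      rintro q ⟨hq, hqy⟩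
      refine ⟨hq, fun hinj => hfree i _ (fun k => ?_) ?_⟩
      · rcases eq_or_ne k j with rfl | hk
        · simpa using hQA hq
        · simp [Function.update_of_ne hk]
      · intro a b hab
        dsimp only at hab
        by_cases ha : a = j <;> by_cases hb : b = j
        · rw [ha, hb]
        · subst ha
          rw [Function.update_self, Function.update_of_ne hb] at hab
          exact absurd ⟨b, hab.symm⟩ hqy
        · subst hb
          rw [Function.update_self, Function.update_of_ne ha] at hab
          exact absurd ⟨a, hab⟩ hqy
        · rw [Function.update_of_ne ha, Function.update_of_ne hb] at hab
          exact hinj ha hb (Subtype.ext hab)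
    · exact hd n.down
  obtain ⟨x, hxQ, hx⟩ := hMA.exists_mem_closure hκ hQne V hV hVd
  refine ⟨x, hxQ, fun n => hx (Sum.inr ⟨n⟩), fun i t ht hinj => ?_⟩
  by_cases hj : ∃ j, t j = x
  · obtain ⟨j, hj⟩ := hj
    obtain ⟨a, ha⟩ := hQne
    have hmem : ∀ k, k ≠ j → t k ∈ A := fun k hk =>
      (ht k).resolve_left fun h => hk (hinj (h.trans hj.symm))
    -- The value at `j` is a dummy, overwritten by `x`; hence injectivity is asked only off `j`.
    let y : Fin (N i).arity → A := fun k => if hk : k = j then ⟨a, hQA ha⟩ else ⟨t k, hmem k hk⟩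
    have hup : Function.update (fun k => (y k : X)) j x = t := by
      funext k
      rcases eq_or_ne k j with rfl | hk
      · simp [hj]
      · simp [y, hk]
    have := hx (Sum.inl ⟨i, j, y⟩) (fun b hb c hc hbc => hinj ?_)
    · simpa only [hup] using this
    · have hb' : b ≠ j := hb
      have hc' : c ≠ j := hc
      simpa [y, hb', hc'] using hbc
  · exact hfree i t (fun k => (ht k).resolve_left fun h => hj ⟨k, h⟩) hinj

/-! ### The transfinite construction -/

theorem IsRelFree.mono {X : Type*} {R : FinitaryRelation X} {S T : Set X} (hST : S ⊆ T)
    (hT : IsRelFree R T) : IsRelFree R S := fun x hx => hT x fun i => hST (hx i)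

theorem IsRelFree.sUnion {X : Type*} {R : FinitaryRelation X} {𝒞 : Set (Set X)}
    (hne : 𝒞.Nonempty) (hdir : DirectedOn (· ⊆ ·) 𝒞) (h : ∀ S ∈ 𝒞, IsRelFree R S) :
    IsRelFree R (⋃₀ 𝒞) := by
  intro x hx
  obtain ⟨S, hS, hxS⟩ := hdir.exists_mem_subset_of_finite_of_subset_sUnion hne (finite_range x)
    (range_subset_iff.2 hx)
  exact h S hS x fun i => hxS ⟨i, rfl⟩

/-- A transfinite construction: given a property of sets that passes to subsets and to directed
unions, and for each index `t` a family `E t` of countable sets, there is a set `F` with the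
property that contains a member of `E t` whenever one of them was compatible with the part of `F`
constructed before stage `t`. -/
theorem exists_saturated_of_directed {X I : Type u} [LinearOrder I] [WellFoundedLT I]
    (hI : ∀ t : I, #(Iio t) < 𝔠) (p : Set X → Prop)
    (hdir : ∀ 𝒞 : Set (Set X), 𝒞.Nonempty → DirectedOn (· ⊆ ·) 𝒞 → (∀ S ∈ 𝒞, p S) → p (⋃₀ 𝒞))
    {A₀ : Set X} (hA₀ : A₀.Countable) (hpA₀ : p A₀) (E : I → Set (Set X))
    (hE : ∀ t, ∀ B ∈ E t, B.Countable) :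
    ∃ (F : Set X) (S : I → Set X), A₀ ⊆ F ∧ p F ∧ ∀ t, S t ⊆ F ∧ #(S t) < 𝔠 ∧
      ((∃ B ∈ E t, p (S t ∪ B)) → ∃ B ∈ E t, B ⊆ F) := by
  classical
  let step : I → Set X → Set X := fun t S =>
    if h : ∃ B ∈ E t, p (S ∪ B) then h.choose else ∅
  have hstep : ∀ t S, p S → p (S ∪ step t S) := by
    intro t S hS
    by_cases h : ∃ B ∈ E t, p (S ∪ B)
    · simpa only [step, dif_pos h] using h.choose_spec.2
    · simpa only [step, dif_neg h, union_empty] using hS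
  have hstep_countable : ∀ t S, (step t S).Countable := by
    intro t S
    by_cases h : ∃ B ∈ E t, p (S ∪ B)
    · simpa only [step, dif_pos h] using hE t _ h.choose_spec.1
    · simp only [step, dif_neg h, countable_empty]
  -- `A t` is what stage `t` adds, `S t` what precedes it.
  let A : I → Set X := (wellFounded_lt (α := I)).fix fun t A => step t (A₀ ∪ ⋃ s : Iio t, A s s.2)
  let S : I → Set X := fun t => A₀ ∪ ⋃ s : Iio t, A s
  have hA : ∀ t, A t = step t (S t) := fun t => WellFounded.fix_eq _ _ t
  have hAJ : ∀ {J : Set I} {s}, s ∈ J → A s ⊆ A₀ ∪ ⋃ s : J, A s := fun {J s} hs =>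
    subset_union_of_subset_right (subset_iUnion (fun s : J => A s) ⟨s, hs⟩) _
  have hAS : ∀ {s t}, s < t → S s ∪ A s ⊆ S t := by
    intro s t hst
    refine union_subset (union_subset_union_right _ (iUnion_subset fun r => ?_))
      (hAJ hst)
    exact subset_iUnion_of_subset (⟨r, r.2.trans hst⟩ : Iio t) subset_rfl
  have hlower : ∀ J : Set I, IsLowerSet J → (∀ s ∈ J, p (S s)) → p (A₀ ∪ ⋃ s : J, A s) := by
    intro J hJlower hJ
    let 𝒞 : Set (Set X) := insert A₀ ((fun s => S s ∪ A s) '' J)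
    have hchain : DirectedOn (· ⊆ ·) 𝒞 := by
      refine IsChain.directedOn (IsChain.insert ?_ ?_)
      · rintro _ ⟨s, -, rfl⟩ _ ⟨t, -, rfl⟩ -
        rcases lt_trichotomy s t with h | rfl | h
        · exact Or.inl ((hAS h).trans subset_union_left)
        · exact Or.inl subset_rfl
        · exact Or.inr ((hAS h).trans subset_union_left)
      · rintro _ ⟨s, -, rfl⟩ -
        exact Or.inl (subset_union_left.trans subset_union_left)
    have hC : ∀ B ∈ 𝒞, p B := by
      rintro _ (rfl | ⟨s, hs, rfl⟩)
      · exact hpA₀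
      · simpa only [hA s] using hstep s _ (hJ s hs)
    convert hdir 𝒞 (insert_nonempty _ _) hchain hC using 1
    refine Subset.antisymm (union_subset (subset_sUnion_of_mem (mem_insert _ _))
      (iUnion_subset fun s => ?_)) (sUnion_subset ?_)
    · exact subset_union_right.trans
        (subset_sUnion_of_mem (mem_insert_of_mem _ (mem_image_of_mem _ s.2)))
    · rintro _ (rfl | ⟨s, hs, rfl⟩)
      · exact subset_union_left
      · refine union_subset (union_subset_union_right _ (iUnion_subset fun r => ?_)) (hAJ hs)
        exact subset_iUnion_of_subset (⟨r, hJlower r.2.le hs⟩ : J) subset_rfl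
  have hpS : ∀ t, p (S t) := fun t => (wellFounded_lt (α := I)).induction t fun t ih =>
    hlower (Iio t) (isLowerSet_Iio t) ih
  have hA_countable : ∀ t, (A t).Countable := fun t => hA t ▸ hstep_countable t _
  refine ⟨A₀ ∪ ⋃ s : (Set.univ : Set I), A s, S, subset_union_left,
    hlower Set.univ isLowerSet_univ fun t _ => hpS t, fun t => ⟨?_, ?_, fun h => ?_⟩⟩
  · exact union_subset_union_right _ (iUnion_subset fun r =>
      subset_iUnion_of_subset (⟨r, mem_univ _⟩ : (Set.univ : Set I)) subset_rfl)
  · refine (mk_union_le _ _).trans_lt (add_lt_of_lt aleph0_le_continuum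
      (hA₀.le_aleph0.trans_lt aleph0_lt_continuum) ?_)
    refine (mk_iUnion_le _).trans_lt (lt_of_le_of_lt
      (mul_le_mul' le_rfl (ciSup_le' fun s => (hA_countable s).le_aleph0)) ?_)
    exact mul_lt_of_lt aleph0_le_continuum (hI t) aleph0_lt_continuum
  · refine ⟨h.choose, h.choose_spec.1, ?_⟩
    have hAt : A t = h.choose := by rw [hA t]; simp only [step, dif_pos h]
    rw [← hAt]
    exact hAJ (mem_univ t)

theorem mk_le_continuum_of_secondCountable (X : Type u) [TopologicalSpace X] [T0Space X]
    [SecondCountableTopology X] : #X ≤ 𝔠 := by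
  have hinj : Function.Injective fun x : X => {B : countableBasis X | x ∈ B.1} := by
    intro x y h
    refine (isBasis_countableBasis X).inseparable_iff.2 (fun B hB => ?_) |>.eq
    exact Set.ext_iff.1 h ⟨B, hB⟩
  refine (mk_le_of_injective hinj).trans ?_
  rw [mk_set, ← two_power_aleph0]
  exact power_le_power_left two_ne_zero (countable_countableBasis X).le_aleph0

theorem mk_opens_le_continuum (X : Type u) [TopologicalSpace X] [SecondCountableTopology X] :
    #(Opens X) ≤ 𝔠 := by
  have hinj : Function.Injective fun U : Opens X => {B : countableBasis X | B.1 ⊆ U} := by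
    intro U V h
    refine Opens.ext ?_
    rw [(isBasis_countableBasis X).open_eq_sUnion' U.isOpen,
      (isBasis_countableBasis X).open_eq_sUnion' V.isOpen]
    congr 1
    ext B
    exact and_congr_right fun hB => Set.ext_iff.1 h ⟨B, hB⟩
  refine (mk_le_of_injective hinj).trans ?_
  rw [mk_set, ← two_power_aleph0]
  exact power_le_power_left two_ne_zero (countable_countableBasis X).le_aleph0

theorem MACountable.exists_isRelFree_superset (hMA : MACountable) {X : Type u}
    [TopologicalSpace X] [PolishSpace X] {ι : Type u} (hι : #ι < 𝔠)
    (N : ι → FinitaryRelation X) (hclosed : ∀ i, IsClosed (N i).carrier) {A : Set X}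
    (hA : A.Countable) (hfree : ∀ i, IsRelFree (N i) A) :
    ∃ F : Set X, A ⊆ F ∧ (∀ i, IsRelFree (N i) F) ∧
      ∀ Q ⊆ F, Q.Countable → Q.Nonempty → Preperfect Q → ∀ O : ℕ → Set X, (∀ n, IsOpen (O n)) →
        (∀ n, Q ⊆ closure (Q ∩ O n)) → ∃ x ∈ F, x ∈ closure Q ∧ ∀ n, x ∈ O n := by
  let T : Type u := (ℕ → X) × (ℕ → Opens X)
  have hT : #T ≤ 𝔠 := by
    have h1 : #(ℕ → X) ≤ 𝔠 := by
      simpa using power_le_power_right (c := ℵ₀) (mk_le_continuum_of_secondCountable X)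
    have h2 : #(ℕ → Opens X) ≤ 𝔠 := by
      simpa using power_le_power_right (c := ℵ₀) (mk_opens_le_continuum X)
    simpa [T] using mul_le_mul' h1 h2
  -- An initial ordinal, so proper initial segments have size below `𝔠`.
  let I : Type u := (#T).ord.ToType
  have e : Nonempty (I ≃ T) := Cardinal.eq.1 (by simp [I])
  obtain ⟨e⟩ := e
  let E : I → Set (Set X) := fun t =>
    {B | ∃ x ∈ closure (range (e t).1), (∀ n, x ∈ (e t).2 n) ∧ B = insert x (range (e t).1)}
  obtain ⟨F, S, hAF, hF, hS⟩ := exists_saturated_of_directed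
    (fun t : I => (mk_Iio_lt t (by simp [I])).trans_le (by simpa [I] using hT)) (fun S => ∀ i, IsRelFree (N i) S)
    (fun 𝒞 hne hdir h i => IsRelFree.sUnion hne hdir fun S hS => h S hS i) hA hfree E
    (by
      rintro t _ ⟨x, -, -, rfl⟩
      exact (countable_range _).insert x)
  refine ⟨F, hAF, hF, fun Q hQF hQc hQne hQ O hO hd => ?_⟩
  obtain ⟨q, rfl⟩ := hQc.exists_eq_range hQne
  obtain ⟨t, ht⟩ := e.surjective (q, fun n => ⟨O n, hO n⟩)
  obtain ⟨hSF, hSc, h⟩ := hS t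
  have hU : #(S t ∪ range q : Set X) < 𝔠 :=
    (mk_union_le _ _).trans_lt (add_lt_of_lt aleph0_le_continuum hSc
      (hQc.le_aleph0.trans_lt aleph0_lt_continuum))
  -- `S t ∪ Q` is free because it lies in the final `F`, so no bookkeeping of when `Q` appears is
  -- needed.
  obtain ⟨x, hxq, hxO, hx⟩ := hMA.exists_isRelFree_insert hι N hclosed hU
    (fun i => (hF i).mono (union_subset hSF hQF)) subset_union_right hQne hQ O hO hd
  obtain ⟨_, ⟨y, hyq, hyO, rfl⟩, hyF⟩ := h ⟨insert x (range q), ⟨x, by simpa [ht] using hxq,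
    by simpa [ht] using hxO, by simp [ht]⟩, by simpa [union_insert] using hx⟩
  exact ⟨y, hyF (mem_insert _ _), by simpa [ht] using hyq, by simpa [ht] using hyO⟩

/-! ### The completely Baire property -/

/-- If `C` is not Baire, dense open sets of `C` have no common point in some non-empty open part. A
countable dense subset of that part is a counterexample `Q`. -/
theorem completelyBaire_of_forall_countable {X : Type*} [TopologicalSpace X] [T1Space X]
    [SecondCountableTopology X] {F : Set X}
    (hF : ∀ Q ⊆ F, Q.Countable → Q.Nonempty → Preperfect Q → ∀ O : ℕ → Set X,
      (∀ n, IsOpen (O n)) → (∀ n, Q ⊆ closure (Q ∩ O n)) →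
        ∃ x ∈ F, x ∈ closure Q ∧ ∀ n, x ∈ O n) :
    CompletelyBaire F := by
  intro C hC
  refine ⟨fun f hfo hfd => ?_⟩
  by_contra hnd
  obtain ⟨z, hz⟩ := not_forall.1 hnd
  rw [mem_closure_iff] at hz
  push Not at hz
  obtain ⟨U, hU, hzU, hUf⟩ := hz
  let j : C → X := fun c => c.1.1
  have hj : IsInducing j := IsInducing.subtypeVal.comp IsInducing.subtypeVal
  have hjinj : Function.Injective j := Subtype.val_injective.comp Subtype.val_injective
  obtain ⟨D, hDc, hDd⟩ := exists_countable_dense C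
  obtain ⟨V, hV, rfl⟩ := hj.isOpen_iff.1 hU
  choose O hO hOf using fun n => hj.isOpen_iff.1 (hfo n)
  let Q : Set X := j '' (D ∩ j ⁻¹' V)
  have hmeet : ∀ W : Set C, IsOpen W → W ⊆ j ⁻¹' V → W.Nonempty → ∃ c ∈ W, j c ∈ Q := by
    intro W hW hWV hWne
    obtain ⟨c, hcW, hcD⟩ := hDd.inter_open_nonempty W hW hWne
    exact ⟨c, hcW, c, ⟨hcD, hWV hcW⟩, rfl⟩
  have hQpre : Preperfect Q := by
    rw [preperfect_iff_nhds]
    rintro _ ⟨c, ⟨hcD, hcV⟩, rfl⟩ G hG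
    obtain ⟨G', hG'G, hG', hcG'⟩ := mem_nhds_iff.1 hG
    obtain ⟨d, hd, hdQ⟩ := hmeet (j ⁻¹' ((G' ∩ V) \ {j c}))
      (((hG'.inter hV).sdiff isClosed_singleton).preimage hj.continuous)
      (fun d hd => hd.1.2) (by
        -- An isolated point would belong to every dense `f n`.
        by_contra hemp
        rw [not_nonempty_iff_eq_empty] at hemp
        have hsing : j ⁻¹' (G' ∩ V) = {c} := by
          refine Subset.antisymm (fun d hd => ?_) (by rintro _ rfl; exact ⟨hcG', hcV⟩)
          by_contra hdc
          have : d ∈ j ⁻¹' ((G' ∩ V) \ {j c}) := ⟨hd, fun h => hdc (hjinj h)⟩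
          rw [hemp] at this
          exact this
        have hcf : c ∈ ⋂ n, f n := by
          refine mem_iInter.2 fun n => ?_
          obtain ⟨d, hd, hdf⟩ := (hfd n).inter_open_nonempty (j ⁻¹' (G' ∩ V))
            ((hG'.inter hV).preimage hj.continuous) ⟨c, hcG', hcV⟩
          rw [hsing] at hd
          exact hd ▸ hdf
        have : c ∈ j ⁻¹' V ∩ ⋂ n, f n := ⟨hcV, hcf⟩
        rw [hUf] at this
        exact this)
    exact ⟨j d, ⟨hG'G hd.1.1, hdQ⟩, hd.2⟩
  -- Intersecting with `V` keeps the point found inside `V`, which `closure Q` alone would not.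
  have hQO : ∀ n, Q ⊆ closure (Q ∩ (O n ∩ V)) := by
    rintro n _ ⟨c, ⟨hcD, hcV⟩, rfl⟩
    refine mem_closure_iff.2 fun G hG hcG => ?_
    obtain ⟨d, ⟨hd, hdn⟩, hdQ⟩ := hmeet (j ⁻¹' (G ∩ V) ∩ f n)
      (((hG.inter hV).preimage hj.continuous).inter (hfo n)) (fun d hd => hd.1.2)
      ((hfd n).inter_open_nonempty _ ((hG.inter hV).preimage hj.continuous) ⟨c, hcG, hcV⟩)
    rw [← hOf n] at hdn
    exact ⟨j d, hd.1, hdQ, hdn, hd.2⟩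
  obtain ⟨d, -, hdQ⟩ := hmeet (j ⁻¹' V) hU subset_rfl ⟨z, hzU⟩
  obtain ⟨x, hxF, hxQ, hxO⟩ := hF Q (by rintro _ ⟨c, -, rfl⟩; exact c.1.2)
    ((hDc.mono inter_subset_left).image j) ⟨_, hdQ⟩ hQpre (fun n => O n ∩ V)
    (fun n => (hO n).inter hV) hQO
  have hxC : (⟨x, hxF⟩ : F) ∈ C := by
    rw [← hC.closure_eq, closure_subtype]
    refine closure_mono ?_ hxQ
    rintro _ ⟨c, -, rfl⟩
    exact ⟨c.1, c.2, rfl⟩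
  have : (⟨⟨x, hxF⟩, hxC⟩ : C) ∈ j ⁻¹' V ∩ ⋂ n, f n := by
    refine ⟨(hxO 0).2, mem_iInter.2 fun n => ?_⟩
    rw [← hOf n]
    exact (hxO n).1
  rw [hUf] at this
  exact this

theorem FinitaryRelation.IsMeager.exists_isClosed_cover {X : Type*} [TopologicalSpace X]
    {R : FinitaryRelation X} (hR : R.IsMeager) :
    ∃ K : ℕ → Set (Fin R.arity → X), (∀ n, IsClosed (K n) ∧ IsNowhereDense (K n)) ∧
      R.carrier ⊆ ⋃ n, K n := by
  obtain ⟨S, hS, hSc, hRS⟩ := isMeagre_iff_countable_union_isNowhereDense.1 hR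
  obtain ⟨s, hs⟩ := (hSc.insert ∅).exists_eq_range (insert_nonempty _ _)
  refine ⟨fun n => closure (s n), fun n => ⟨isClosed_closure, ?_⟩, fun x hx => ?_⟩
  · have hn : s n ∈ insert ∅ S := hs ▸ mem_range_self n
    rcases hn with hn | hn
    · simp [hn]
    · exact (hS _ hn).closure
  · obtain ⟨t, ht, hxt⟩ := hRS hx
    obtain ⟨n, rfl⟩ : t ∈ range s := hs ▸ mem_insert_of_mem _ ht
    exact mem_iUnion.2 ⟨n, subset_closure hxt⟩

/-- A crowded space is a non-empty space without isolated points; `F` is regarded as a subspace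
of `X` when it is claimed to be completely Baire. -/
theorem theorem5p5 (hMA : MACountable)
    {X : Type*} [TopologicalSpace X] [PolishSpace X] [Nonempty X] [PerfectSpace X]
    (𝓡 : Set (FinitaryRelation X)) (hmeager : ∀ R ∈ 𝓡, R.IsMeager) (hcard : #𝓡 < 𝔠) :
    ∃ F : Set X, Dense F ∧ CompletelyBaire F ∧ ∀ R ∈ 𝓡, IsRelFree R F := by
  choose K hK hcover using fun R : 𝓡 => (hmeager R.1 R.2).exists_isClosed_cover
  let N : 𝓡 × ℕ → FinitaryRelation X := fun p => ⟨p.1.1.arity, p.1.1.one_le_arity, K p.1 p.2⟩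
  have hι : #(𝓡 × ℕ) < 𝔠 := by
    simpa using mul_lt_of_lt aleph0_le_continuum hcard aleph0_lt_continuum
  obtain ⟨x, hxd, hx⟩ := hMA.exists_denseRange_isRelFree hι N (fun p => (hK p.1 p.2).1)
    (fun p => (hK p.1 p.2).2)
  obtain ⟨F, hxF, hfree, hF⟩ := hMA.exists_isRelFree_superset hι N (fun p => (hK p.1 p.2).1)
    (countable_range x) hx
  refine ⟨F, Dense.mono hxF hxd, completelyBaire_of_forall_countable hF,
    fun R hR t ht hinj htR => ?_⟩
  obtain ⟨n, hn⟩ := mem_iUnion.1 (hcover ⟨R, hR⟩ htR)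
  exact hfree (⟨R, hR⟩, n) t ht hinj hn
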